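/- Let $\{0,1\}^*$ be the set of finite binary strings. For $f:\{0,1\}^*\to\{0,1\}$ let $\bar f(x)$ be the string $x$ with the token $f(x)$ appended, and for $T\in\mathbb{N}_+$ let $f^{\mathrm{e2e}\text{-}T}(x)$ be the last token of $\bar f\circ\cdots\circ\bar f\,(x)$ ($T$ applications). For a base class $\mathcal F\subseteq\{0,1\}^{\{0,1\}^*}$ put $\mathrm{e2e}^T(\mathcal F)=\{f^{\mathrm{e2e}\text{-}T}: f\in\mathcal F\}$, and let $\mathrm{VCdim}\in\mathbb{N}\cup\{\infty\}$ denote the Vapnik–Chervonenkis dimension (the supremum of the sizes of shattered finite sets). A learning rule $A$ maps finite sequences of pairs in $\{0,1\}^*\times\{0,1\}$ to functions $\{0,1\}^*\to\{0,1\}$. It *learns $\mathrm{e2e}^T(\mathcal F)$ end-to-end with sample complexity $m(\varepsilon,\delta)\in\mathbb{N}$* if for every probability distribution $\mathcal D$ on $\{0,1\}^*$, every $f_*\in\mathcal F$ and all $0<\varepsilon,\delta<1$, with probability at least $1-\delta$ over $x_1,\dots,x_m\sim\mathcal D$ i.i.d., $m=m(\varepsilon,\delta)$, the predictor $h=A\big((x_i,f_*^{\mathrm{e2e}\text{-}T}(x_i))_{i\le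 m}\big)$ satisfies $\Pr_{x\sim\mathcal D}\big(h(x)\ne f_*^{\mathrm{e2e}\text{-}T}(x)\big)\le\varepsilon$. The rule $A$ *implements $\mathrm{Cons}_{\mathrm{e2e}}$* if, for every sample $S$ for which some $f\in\mathcal F$ satisfies $f^{\mathrm{e2e}\text{-}T}(x)=y$ for all $(x,y)\in S$, it returns $A(S)=\hat f^{\,\mathrm{e2e}\text{-}T}$ for some $\hat f\in\mathcal F$ with this property. **Theorem.** 1. For every $\mathcal F\subseteq\{0,1\}^{\{0,1\}^*}$ and $T\in\mathbb{N}_+$, $$\mathrm{VCdim}(\mathrm{e2e}^T(\mathcal F))\le 6\,T\cdot\mathrm{VCdim}(\mathcal F).$$ 2. For every $\varepsilon_0\in(0,1)$ there is a constant $c>0$, depending on $\varepsilon_0$ only, such that for every $\mathcal F\subseteq\{0,1\}^{\{0,1\}^*}$ with $\mathrm{VCdim}(\mathcal F)<\infty$ and every $T\in\mathbb{N}_+$ there is a function $m(\varepsilon,\delta)$ with $$m(\varepsilon,\delta)\le \frac{c}{\varepsilon}\Big(T\cdot\mathrm{VCdim}(\mathcal F)\,\log\frac1\varepsilon+\log\frac1\delta\Big)\qquad\text{for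 all }0<\varepsilon\le\varepsilon_0,\ 0<\delta<1,$$ such that rules implementing $\mathrm{Cons}_{\mathrm{e2e}}$ exist and every such rule learns $\mathrm{e2e}^T(\mathcal F)$ end-to-end with sample complexity $m(\varepsilon,\delta)$. -/

import Mathlib

open MeasureTheory

noncomputable section

namespace AutoregressiveCoT

/-- The apply-and-append map `x ↦ append (x, f x)` of a next-token generator `f : Σ* → Σ`. -/
def applyAppend {α : Type*} (f : List α → α) (x : List α) : List α := x ++ [f x]

/-- The `T`-step chain of thought: `T` iterations of the apply-and-append map. -/
def chainOfThought {α : Type*} (f : List α → α) (T : ℕ) (x : List α) : List α :=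
  (applyAppend f)^[T] x

theorem chainOfThought_ne_nil {α : Type*} (f : List α → α) (T : ℕ+) (x : List α) :
    chainOfThought f T x ≠ [] := by
  obtain ⟨n, hn⟩ := Nat.exists_eq_succ_of_ne_zero T.ne_zero
  unfold chainOfThought
  rw [hn, Function.iterate_succ_apply']
  simp [applyAppend]

/-- The end-to-end map of `f`: the last token of its `T`-step chain of thought. -/
def endToEnd {α : Type*} (f : List α → α) (T : ℕ+) (x : List α) : α :=
  (chainOfThought f T x).getLast (chainOfThought_ne_nil f T x)

/-- The end-to-end class of a base class `F`. -/
def endToEndClass {α : Type*} (F : Set (List α → α)) (T : ℕ+) : Set (List α → α) :=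
  {h | ∃ f ∈ F, h = endToEnd f T}

/-- `H` shatters the finite set `S`: every labelling of the points of `S` is realized by some
`h ∈ H`. -/
def Shatters {X : Type*} (H : Set (X → Bool)) (S : Finset X) : Prop :=
  ∀ b : S → Bool, ∃ h ∈ H, ∀ x : S, h x = b x

/-- The VC dimension: the supremum of the sizes of the shattered finite sets, `⊤` if these sizes
are unbounded. -/
def VCdim {X : Type*} (H : Set (X → Bool)) : ℕ∞ :=
  ⨆ (S : Finset X) (_ : Shatters H S), (S.card : ℕ∞)

/-- Every set of finite binary strings is measurable. -/
instance instMeasurableSpaceStrings : MeasurableSpace (List Bool) := ⊤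

/-- A learning rule maps a finite sequence of labelled inputs to a predictor. -/
abbrev LearningRule : Type := List (List Bool × Bool) → (List Bool → Bool)

/-- The sample `((x₁, y₁), …, (xₘ, yₘ))` with labels `yᵢ` given by the end-to-end map of `f`. -/
def labelledSample (f : List Bool → Bool) (T : ℕ+) {m : ℕ} (x : Fin m → List Bool) :
    List (List Bool × Bool) :=
  List.ofFn fun i => (x i, endToEnd f T (x i))

/-- The population error `P_{x ∼ D} (h x ≠ endToEnd f T x)`. -/
def populationError (D : Measure (List Bool)) (f : List Bool → Bool) (T : ℕ+)
    (h : List Bool → Bool) : ℝ :=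
  D.real {x | h x ≠ endToEnd f T x}

/-- The rule `A` learns the end-to-end class of `F` with sample complexity `m`, in the realizable
end-to-end setting: for every distribution `D` on strings, every `f ∈ F` and all
`ε, δ ∈ (0, 1)`, with probability at least `1 - δ` over `m ε δ` i.i.d. inputs labelled by the
end-to-end map of `f`, the output of `A` has population error at most `ε`. -/
def LearnsEndToEnd (F : Set (List Bool → Bool)) (T : ℕ+) (A : LearningRule)
    (m : ℝ → ℝ → ℕ) : Prop :=
  ∀ (D : Measure (List Bool)) [IsProbabilityMeasure D], ∀ f ∈ F, ∀ ε δ : ℝ,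
    0 < ε → ε < 1 → 0 < δ → δ < 1 →
      1 - δ ≤ (Measure.pi fun _ : Fin (m ε δ) => D).real
        {x | populationError D f T (A (labelledSample f T x)) ≤ ε}

/-- `A` implements the consistency rule: on each sample `S` that is consistent with the
end-to-end map of some member of `F`, it returns the end-to-end map of some `f' ∈ F` that is
consistent with `S`. Its output on other samples is unconstrained. -/
def IsConsRule (F : Set (List Bool → Bool)) (T : ℕ+) (A : LearningRule) : Prop :=
  ∀ S : List (List Bool × Bool),
    (∃ f ∈ F, ∀ p ∈ S, endToEnd f T p.1 = p.2) →
      ∃ f' ∈ F, A S = endToEnd f' T ∧ ∀ p ∈ S, endToEnd f' T p.1 = p.2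

end AutoregressiveCoT

end

/-! On inputs from a finite set `S`, a `T`-step run queries the generator only at strings `x ++ w`
with `x ∈ S` and `w.length < T`, whatever the generator is. These are fewer than `2 ^ T` per input,
so the end-to-end class has at most as many traces on `S` as `F` has on some `S.card * 2 ^ T`
strings (`card_traces_endToEndClass_le`). With `d` the VC dimension of `F`, Sauer–Shelah bounds this
by `(e m 2^T / d)^d`, where `m = S.card`. A shattered `S` has `2 ^ m` traces, and taking logarithms
turns the `2 ^ T` into a factor linear in `T`.

The second claim is realizable uniform convergence for the end-to-end class. If a hypothesis of
error above `ε` fits the sample, then with probability at least `1/2` it errs at `k ≥ ε m / 4`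
positions of a second sample (`half_le_measureReal_disagreements`). Random exchanges between the two
samples preserve their law, and put all these errors in the second sample with probability at most
`2 ^ (-k)` per trace (`card_exchange_single`). A union bound over the traces on `2 m` points then
beats `δ`. -/

namespace AutoregressiveCoT

/-! ### Traces and the Sauer–Shelah bound -/

open scoped Classical in
/-- The traces on `S` of the members of `H`, each viewed as the set where it is `true`. -/
noncomputable def traces {X : Type*} (H : Set (X → Bool)) (S : Finset X) : Finset (Finset X) :=
  S.powerset.filter fun A => ∃ h ∈ H, A = S.filter fun x => h x = true

open scoped Classical in
theorem mem_traces {X : Type*} {H : Set (X → Bool)} {S A : Finset X} :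
    A ∈ traces H S ↔ ∃ h ∈ H, A = S.filter fun x => h x = true := by
  unfold traces
  rw [Finset.mem_filter, Finset.mem_powerset, and_iff_right_iff_imp]
  rintro ⟨h, -, rfl⟩
  exact Finset.filter_subset _ _

theorem Shatters.card_le_VCdim {X : Type*} {H : Set (X → Bool)} {S : Finset X}
    (h : Shatters H S) : (S.card : ℕ∞) ≤ VCdim H :=
  le_iSup₂_of_le (f := fun (S : Finset X) (_ : Shatters H S) => (S.card : ℕ∞)) S h le_rfl

open scoped Classical in
theorem shatters_of_shatters_traces {X : Type*} {H : Set (X → Bool)} {S s : Finset X}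
    (hs : (traces H S).Shatters s) : s ⊆ S ∧ Shatters H s := by
  have hsub : s ⊆ S := by
    obtain ⟨u, hu, hsu⟩ := hs.exists_superset
    exact hsu.trans (Finset.mem_powerset.1 (Finset.mem_filter.1 hu).1)
  refine ⟨hsub, fun b => ?_⟩
  obtain ⟨u, hu, hsu⟩ := hs (t := s.filter fun x => ∃ hx : x ∈ s, b ⟨x, hx⟩ = true)
    (Finset.filter_subset _ _)
  obtain ⟨h, hH, rfl⟩ := mem_traces.1 hu
  refine ⟨h, hH, fun x => ?_⟩
  have hx := Finset.ext_iff.1 hsu x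
  simp only [Finset.mem_inter, Finset.mem_filter, x.2, hsub x.2, true_and, exists_true_left] at hx
  exact Bool.eq_iff_iff.2 hx

open scoped Classical in
/-- The Sauer–Shelah lemma for classes of Boolean functions. -/
theorem card_traces_le_sum_choose {X : Type*} {H : Set (X → Bool)} {d : ℕ}
    (hd : VCdim H ≤ d) (S : Finset X) :
    (traces H S).card ≤ ∑ k ∈ Finset.range (d + 1), S.card.choose k := by
  calc (traces H S).card ≤ (traces H S).shatterer.card := Finset.card_le_card_shatterer _
    _ ≤ ((Finset.range (d + 1)).biUnion fun k => S.powersetCard k).card := by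
        refine Finset.card_le_card fun s hs => ?_
        obtain ⟨hsub, hsh⟩ := shatters_of_shatters_traces (Finset.mem_shatterer.1 hs)
        have hle : s.card ≤ d := by exact_mod_cast hsh.card_le_VCdim.trans hd
        simp only [Finset.mem_biUnion, Finset.mem_range, Finset.mem_powersetCard]
        exact ⟨s.card, by omega, hsub, rfl⟩
    _ ≤ ∑ k ∈ Finset.range (d + 1), (S.powersetCard k).card := Finset.card_biUnion_le
    _ = _ := by simp

/-- For `k ≤ d ≤ n` the weight `(d/n)^k (n/d)^d` is at least `1`. The weighted sum extends to the
full binomial expansion of `(1 + d/n)^n ≤ e^d`. -/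
theorem sum_range_choose_le {d n : ℕ} (hd : 1 ≤ d) (hdn : d ≤ n) :
    (∑ k ∈ Finset.range (d + 1), (n.choose k : ℝ)) ≤ Real.exp d * ((n : ℝ) / d) ^ d := by
  have hd0 : (0 : ℝ) < d := by exact_mod_cast hd
  have hn0 : (0 : ℝ) < n := by exact_mod_cast hd.trans hdn
  have hr1 : (1 : ℝ) ≤ n / d := (one_le_div hd0).2 (by exact_mod_cast hdn)
  have hr0 : (0 : ℝ) < n / d := by positivity
  calc (∑ k ∈ Finset.range (d + 1), (n.choose k : ℝ))
      ≤ ∑ k ∈ Finset.range (d + 1), ((d : ℝ) / n) ^ k * n.choose k * ((n : ℝ) / d) ^ d := by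
        refine Finset.sum_le_sum fun k hk => ?_
        have hkd : k ≤ d := by simpa [Nat.lt_succ_iff] using hk
        have h1 : (1 : ℝ) ≤ ((d : ℝ) / n) ^ k * ((n : ℝ) / d) ^ d := by
          rw [← inv_div (n : ℝ) d, inv_pow, ← div_eq_inv_mul, one_le_div (by positivity)]
          exact pow_le_pow_right₀ hr1 hkd
        have h2 : (0 : ℝ) ≤ n.choose k := by positivity
        nlinarith
    _ = (∑ k ∈ Finset.range (d + 1), ((d : ℝ) / n) ^ k * n.choose k) * ((n : ℝ) / d) ^ d := by
        rw [Finset.sum_mul]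
    _ ≤ (∑ k ∈ Finset.range (n + 1), ((d : ℝ) / n) ^ k * n.choose k) * ((n : ℝ) / d) ^ d := by
        gcongr
    _ = ((d : ℝ) / n + 1) ^ n * ((n : ℝ) / d) ^ d := by
        rw [add_pow]; simp
    _ ≤ Real.exp d * ((n : ℝ) / d) ^ d := by
        gcongr
        calc ((d : ℝ) / n + 1) ^ n ≤ Real.exp ((d : ℝ) / n) ^ n := by
              gcongr; exact Real.add_one_le_exp _
          _ = Real.exp d := by
              rw [← Real.exp_nat_mul]; congr 1; field_simp

theorem card_traces_le {X : Type*} {H : Set (X → Bool)} {d n : ℕ} (hVC : VCdim H ≤ d)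
    (hd : 1 ≤ d) (hdn : d ≤ n) {S : Finset X} (hS : S.card ≤ n) :
    ((traces H S).card : ℝ) ≤ Real.exp d * ((n : ℝ) / d) ^ d := by
  refine le_trans ?_ (sum_range_choose_le hd hdn)
  calc ((traces H S).card : ℝ) ≤ ∑ k ∈ Finset.range (d + 1), (S.card.choose k : ℝ) := by
        exact_mod_cast card_traces_le_sum_choose hVC S
    _ ≤ _ := Finset.sum_le_sum fun k _ => by exact_mod_cast Nat.choose_le_choose k hS

theorem Shatters.card_traces {X : Type*} {H : Set (X → Bool)} {S : Finset X}
    (h : Shatters H S) : (traces H S).card = 2 ^ S.card := by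
  classical
  rw [← Finset.card_powerset]
  congr 1
  ext A
  rw [mem_traces, Finset.mem_powerset]
  constructor
  · rintro ⟨h, -, rfl⟩
    exact Finset.filter_subset _ _
  · intro hA
    obtain ⟨g, hg, hgb⟩ := h fun x => decide ((x : X) ∈ A)
    refine ⟨g, hg, ?_⟩
    ext x
    rw [Finset.mem_filter]
    constructor
    · intro hx
      exact ⟨hA hx, by simpa [hx] using hgb ⟨x, hA hx⟩⟩
    · rintro ⟨hxS, hx⟩
      simpa [hx] using hgb ⟨x, hxS⟩

/-! ### Strings queried by a chain of thought -/

/-- The binary strings of length less than `n`. -/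
def shortStrings : ℕ → Finset (List Bool)
  | 0 => ∅
  | n + 1 => insert [] ((shortStrings n).image (List.cons true) ∪
      (shortStrings n).image (List.cons false))

theorem card_shortStrings_lt (n : ℕ) : (shortStrings n).card < 2 ^ n := by
  induction n with
  | zero => simp [shortStrings]
  | succ n ih =>
    have h1 := Finset.card_insert_le ([] : List Bool)
      ((shortStrings n).image (List.cons true) ∪ (shortStrings n).image (List.cons false))
    have h2 := Finset.card_union_le ((shortStrings n).image (List.cons true))
      ((shortStrings n).image (List.cons false))
    have h3 : ∀ b, ((shortStrings n).image (List.cons b)).card ≤ (shortStrings n).card :=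
      fun b => Finset.card_image_le
    have h4 := h3 true
    have h5 := h3 false
    rw [shortStrings, pow_succ]
    omega

theorem mem_shortStrings {n : ℕ} {w : List Bool} (hw : w.length < n) : w ∈ shortStrings n := by
  induction n generalizing w with
  | zero => simp at hw
  | succ n ih =>
    rcases w with _ | ⟨b, w⟩
    · simp [shortStrings]
    · have := ih (w := w) (by simpa using hw)
      cases b <;> simp [shortStrings, this]

theorem chainOfThought_eq_append {α : Type*} (f : List α → α) (n : ℕ) (x : List α) :
    ∃ w : List α, w.length = n ∧ chainOfThought f n x = x ++ w := by
  induction n with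
  | zero => exact ⟨[], rfl, by simp [chainOfThought]⟩
  | succ n ih =>
    obtain ⟨w, hw, h⟩ := ih
    refine ⟨w ++ [f (x ++ w)], by simp [hw], ?_⟩
    unfold chainOfThought at h ⊢
    rw [Function.iterate_succ_apply', h]
    simp [applyAppend]

/-- The chain of length `n` makes its queries after `0, …, n - 1` appended tokens, hence the strict
inequality. -/
theorem chainOfThought_congr {α : Type*} {f g : List α → α} {n : ℕ} {x : List α}
    (h : ∀ w : List α, w.length < n → f (x ++ w) = g (x ++ w)) :
    chainOfThought f n x = chainOfThought g n x := by
  induction n with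
  | zero => rfl
  | succ n ih =>
    have hn := ih fun w hw => h w (hw.trans n.lt_succ_self)
    obtain ⟨w, hw, hfw⟩ := chainOfThought_eq_append f n x
    have hfg := h w (by omega)
    rw [← hfw] at hfg
    unfold chainOfThought at hn hfg ⊢
    rw [Function.iterate_succ_apply', Function.iterate_succ_apply', ← hn, applyAppend, applyAppend,
      hfg]

theorem endToEnd_congr {α : Type*} {f g : List α → α} {T : ℕ+} {x : List α}
    (h : ∀ w : List α, w.length < T → f (x ++ w) = g (x ++ w)) :
    endToEnd f T x = endToEnd g T x := by
  simp only [endToEnd, chainOfThought_congr h]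

/-- The strings on which a generator is evaluated in `T` steps from the points of `S`. -/
def reachable (S : Finset (List Bool)) (T : ℕ) : Finset (List Bool) :=
  (S ×ˢ shortStrings T).image fun p => p.1 ++ p.2

theorem card_reachable_le (S : Finset (List Bool)) (T : ℕ) :
    (reachable S T).card ≤ S.card * 2 ^ T := by
  refine Finset.card_image_le.trans ?_
  rw [Finset.card_product]
  exact Nat.mul_le_mul_left _ (card_shortStrings_lt T).le

/-- Choosing a generator for each end-to-end trace gives an injection: its trace on the queried
strings determines every run from `S`. -/
theorem card_traces_endToEndClass_le (F : Set (List Bool → Bool)) (T : ℕ+)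
    (S : Finset (List Bool)) :
    (traces (endToEndClass F T) S).card ≤ (traces F (reachable S T)).card := by
  classical
  have hex : ∀ A ∈ traces (endToEndClass F T) S,
      ∃ f ∈ F, A = S.filter fun x => endToEnd f T x = true := by
    intro A hA
    obtain ⟨_, ⟨f, hf, rfl⟩, h⟩ := mem_traces.1 hA
    exact ⟨f, hf, h⟩
  choose! φ hφF hφ using hex
  refine Finset.card_le_card_of_injOn
    (fun A => (reachable S T).filter fun x => φ A x = true) ?_ ?_
  · intro A hA
    exact mem_traces.2 ⟨φ A, hφF A hA, rfl⟩
  · intro A hA B hB hAB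
    rw [hφ A hA, hφ B hB]
    refine Finset.filter_congr fun x hx => ?_
    rw [endToEnd_congr]
    intro w hw
    have hmem : x ++ w ∈ reachable S T :=
      Finset.mem_image.2 ⟨(x, w), Finset.mem_product.2 ⟨hx, mem_shortStrings hw⟩, rfl⟩
    have := Finset.ext_iff.1 hAB (x ++ w)
    simp only [Finset.mem_filter, hmem, true_and] at this
    exact Bool.eq_iff_iff.2 this

/-! ### The VC dimension of the end-to-end class -/

theorem log_le_mul_add {a u : ℝ} (ha : 0 < a) (hu : 0 < u) :
    Real.log u ≤ a * u - Real.log a - 1 := by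
  have := Real.log_le_sub_one_of_pos (mul_pos ha hu)
  rw [Real.log_mul ha.ne' hu.ne'] at this
  linarith

theorem card_le_of_two_pow_le {m d T : ℕ} (hd : 1 ≤ d) (hT : 1 ≤ T) (hm : 1 ≤ m)
    (h : (2 : ℝ) ^ m ≤ Real.exp d * (((m * 2 ^ T : ℕ) : ℝ) / d) ^ d) : m ≤ 6 * T * d := by
  have hd0 : (0 : ℝ) < d := by exact_mod_cast hd
  have hm0 : (0 : ℝ) < m := by exact_mod_cast hm
  have hT1 : (1 : ℝ) ≤ T := by exact_mod_cast hT
  have hlog := Real.log_le_log (by positivity) h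
  push_cast at hlog
  rw [Real.log_mul (by positivity) (by positivity), Real.log_exp, Real.log_pow, Real.log_pow,
    show (m : ℝ) * 2 ^ T / d = m / d * 2 ^ T by ring, Real.log_mul (by positivity) (by positivity),
    Real.log_pow] at hlog
  -- The slope `1/8` costs `m/8` on the right, less than `m log 2`. The intercept `3 log 2 - 1`
  -- cancels the `d` coming from `exp d`, leaving `(T + 3) d log 2 ≤ 4 T d log 2`.
  have hr := log_le_mul_add (a := 1 / 8) (u := (m : ℝ) / d) (by norm_num) (by positivity)
  have h8 : Real.log (1 / 8) = -(3 * Real.log 2) := by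
    rw [one_div, Real.log_inv, show (8 : ℝ) = 2 ^ 3 by norm_num, Real.log_pow]; norm_num
  rw [h8] at hr
  have hl1 := Real.log_two_gt_d9
  have hl2 := Real.log_two_lt_d9
  have hmul : (d : ℝ) * Real.log (m / d) ≤ m / 8 + d * (3 * Real.log 2 - 1) := by
    calc (d : ℝ) * Real.log (m / d) ≤ d * (1 / 8 * (m / d) - -(3 * Real.log 2) - 1) := by gcongr
      _ = m / 8 + d * (3 * Real.log 2 - 1) := by field_simp; ring
  have hdT : (d : ℝ) ≤ T * d := by nlinarith
  have key : (m : ℝ) * (Real.log 2 - 1 / 8) ≤ 4 * Real.log 2 * (T * d) := by nlinarith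
  have : (m : ℝ) ≤ 6 * T * d := by nlinarith
  exact_mod_cast this

theorem VCdim_le_of_card_le {X : Type*} {H : Set (X → Bool)} {n : ℕ∞}
    (h : ∀ S, Shatters H S → (S.card : ℕ∞) ≤ n) : VCdim H ≤ n :=
  iSup₂_le h

theorem subsingleton_of_VCdim_eq_zero {X : Type*} {H : Set (X → Bool)} (h : VCdim H = 0) :
    H.Subsingleton := by
  intro f hf g hg
  by_contra hne
  obtain ⟨x, hx⟩ := Function.ne_iff.1 hne
  have hsh : Shatters H {x} := by
    intro b
    have hb : f x = b ⟨x, by simp⟩ ∨ g x = b ⟨x, by simp⟩ := by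
      revert hx
      cases f x <;> cases g x <;> cases b ⟨x, by simp⟩ <;> simp
    rcases hb with hb | hb
    · exact ⟨f, hf, by rintro ⟨y, hy⟩; obtain rfl := Finset.mem_singleton.1 hy; exact hb⟩
    · exact ⟨g, hg, by rintro ⟨y, hy⟩; obtain rfl := Finset.mem_singleton.1 hy; exact hb⟩
  have := hsh.card_le_VCdim
  simp [h] at this

theorem VCdim_eq_zero_of_subsingleton {X : Type*} {H : Set (X → Bool)} (h : H.Subsingleton) :
    VCdim H = 0 := by
  refine le_antisymm (VCdim_le_of_card_le fun S hS => ?_) zero_le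
  have hempty : S = ∅ := by
    by_contra hne
    obtain ⟨x, hx⟩ := Finset.nonempty_iff_ne_empty.2 hne
    obtain ⟨f, hf, hft⟩ := hS fun _ => true
    obtain ⟨g, hg, hgt⟩ := hS fun _ => false
    have h1 := hft ⟨x, hx⟩
    have h2 := hgt ⟨x, hx⟩
    rw [h hf hg, h2] at h1
    exact Bool.noConfusion h1
  simp [hempty]

theorem endToEndClass_subsingleton {F : Set (List Bool → Bool)} (h : F.Subsingleton) (T : ℕ+) :
    (endToEndClass F T).Subsingleton := by
  rintro _ ⟨f, hf, rfl⟩ _ ⟨g, hg, rfl⟩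
  rw [h hf hg]

theorem VCdim_endToEndClass_le (F : Set (List Bool → Bool)) (T : ℕ+) :
    VCdim (endToEndClass F T) ≤ 6 * ((T : ℕ) : ℕ∞) * VCdim F := by
  rcases eq_or_ne (VCdim F) ⊤ with htop | hfin
  · rw [htop, ENat.mul_top]
    · exact le_top
    · simp
  obtain ⟨d, hd⟩ := ENat.ne_top_iff_exists.1 hfin
  rcases Nat.eq_zero_or_pos d with rfl | hd1
  · rw [VCdim_eq_zero_of_subsingleton
      (endToEndClass_subsingleton (subsingleton_of_VCdim_eq_zero hd.symm) T)]
    exact zero_le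
  rw [← hd]
  refine VCdim_le_of_card_le fun S hS => ?_
  have hT : 1 ≤ (T : ℕ) := T.pos
  suffices S.card ≤ 6 * T * d by exact_mod_cast this
  -- The closed form of Sauer–Shelah needs at least `d` points; smaller sets satisfy the bound
  -- trivially.
  rcases lt_or_ge S.card d with hlt | hge
  · nlinarith
  have h2T : 1 ≤ 2 ^ (T : ℕ) := Nat.one_le_two_pow
  refine card_le_of_two_pow_le hd1 hT (le_trans hd1 hge) ?_
  have hcard := card_traces_endToEndClass_le F T S
  rw [hS.card_traces] at hcard
  calc (2 : ℝ) ^ S.card ≤ ((traces F (reachable S T)).card : ℝ) := by exact_mod_cast hcard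
    _ ≤ _ := card_traces_le hd.symm.le hd1 (by nlinarith) (card_reachable_le S T)

/-! ### Double samples and random exchanges -/

/-- The positions of the sample `x` on which `h` and `t` disagree. -/
def disagreements {X : Type*} (h t : X → Bool) {m : ℕ} (x : Fin m → X) : Finset (Fin m) :=
  Finset.univ.filter fun i => h (x i) ≠ t (x i)

/-- The pairs of samples for which some `h ∈ H` agrees with `t` on the first sample and disagrees
with it at `k` or more positions of the second. -/
def badPairs {X : Type*} (H : Set (X → Bool)) (t : X → Bool) (m k : ℕ) :
    Set ((Fin m → X) × (Fin m → X)) :=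
  {z | ∃ h ∈ H, (∀ i, h (z.1 i) = t (z.1 i)) ∧ k ≤ (disagreements h t z.2).card}

/-- Exchange the two samples at the positions selected by `σ`. -/
def exchange {X : Type*} {m : ℕ} (σ : Fin m → Bool) (z : (Fin m → X) × (Fin m → X)) :
    (Fin m → X) × (Fin m → X) :=
  (fun i => if σ i then z.2 i else z.1 i, fun i => if σ i then z.1 i else z.2 i)

theorem exchange_involutive {X : Type*} {m : ℕ} (σ : Fin m → Bool) :
    Function.Involutive (exchange (X := X) σ) := by
  intro z
  refine Prod.ext ?_ ?_ <;> funext i <;> cases h : σ i <;> simp [exchange, h]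

/-- Each position where exactly one of the two points is an error forces the value of `σ`, and at
least `k` such positions are needed. -/
theorem card_exchange_single {X : Type*} (h t : X → Bool) {m : ℕ} (k : ℕ)
    (z : (Fin m → X) × (Fin m → X)) :
    (Finset.univ.filter fun σ : Fin m → Bool =>
      (∀ i, h ((exchange σ z).1 i) = t ((exchange σ z).1 i)) ∧
        k ≤ (disagreements h t (exchange σ z).2).card).card * 2 ^ k ≤ 2 ^ m := by
  -- The weight doubles at each error in the second sample and vanishes at an error in the first.
  -- Its product over positions is thus at least `2 ^ k` on the event, while its sum over all `σ`
  -- factors into terms at most `2`.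
  let w : X → X → ℕ := fun p q => if h p = t p then (if h q ≠ t q then 2 else 1) else 0
  let g : Fin m → Bool → ℕ := fun i b =>
    w (if b then z.2 i else z.1 i) (if b then z.1 i else z.2 i)
  have hw : ∀ p q, w p q + w q p ≤ 2 := by
    intro p q
    by_cases h1 : h p = t p <;> by_cases h2 : h q = t q <;> simp [w, h1, h2]
  have hg : ∀ i, ∑ b, g i b ≤ 2 := by
    intro i
    simpa [g] using hw (z.2 i) (z.1 i)
  calc _ = ∑ σ ∈ Finset.univ.filter (fun σ : Fin m → Bool =>
            (∀ i, h ((exchange σ z).1 i) = t ((exchange σ z).1 i)) ∧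
              k ≤ (disagreements h t (exchange σ z).2).card), 2 ^ k := by
        rw [Finset.sum_const, smul_eq_mul]
    _ ≤ ∑ σ ∈ Finset.univ.filter (fun σ : Fin m → Bool =>
            (∀ i, h ((exchange σ z).1 i) = t ((exchange σ z).1 i)) ∧
              k ≤ (disagreements h t (exchange σ z).2).card), ∏ i, g i (σ i) := by
        refine Finset.sum_le_sum fun σ hσ => ?_
        obtain ⟨h1, h2⟩ := (Finset.mem_filter.1 hσ).2
        have : ∏ i, g i (σ i) = 2 ^ (disagreements h t (exchange σ z).2).card := by
          have hgi : ∀ i, g i (σ i) =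
              if h ((exchange σ z).2 i) ≠ t ((exchange σ z).2 i) then 2 else 1 :=
            fun i => if_pos (h1 i)
          rw [Finset.prod_congr rfl fun i _ => hgi i, ← Finset.prod_filter, Finset.prod_const]
          rfl
        rw [this]
        exact Nat.pow_le_pow_right two_pos h2
    _ ≤ ∑ σ : Fin m → Bool, ∏ i, g i (σ i) :=
        Finset.sum_le_sum_of_subset (Finset.filter_subset _ _)
    _ = ∏ i, ∑ b, g i b := by
        rw [Finset.prod_univ_sum, Fintype.piFinset_univ]
    _ ≤ ∏ _i : Fin m, 2 := Finset.prod_le_prod' fun i _ => hg i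
    _ = 2 ^ m := by simp

open scoped Classical in
/-- The points occurring in a pair of samples. -/
noncomputable def samplePoints {X : Type*} {m : ℕ} (z : (Fin m → X) × (Fin m → X)) : Finset X :=
  Finset.univ.image z.1 ∪ Finset.univ.image z.2

theorem card_samplePoints_le {X : Type*} {m : ℕ} (z : (Fin m → X) × (Fin m → X)) :
    (samplePoints z).card ≤ 2 * m := by
  classical
  have h : ∀ x : Fin m → X, (Finset.univ.image x).card ≤ m := fun x =>
    Finset.card_image_le.trans (by simp)
  have h1 := h z.1
  have h2 := h z.2
  have h3 := Finset.card_union_le (Finset.univ.image z.1) (Finset.univ.image z.2)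
  have h4 : (samplePoints z).card = (Finset.univ.image z.1 ∪ Finset.univ.image z.2).card := by
    unfold samplePoints; congr
  omega

theorem exchange_mem_samplePoints {X : Type*} {m : ℕ} (σ : Fin m → Bool)
    (z : (Fin m → X) × (Fin m → X)) (i : Fin m) :
    (exchange σ z).1 i ∈ samplePoints z ∧ (exchange σ z).2 i ∈ samplePoints z := by
  classical
  cases h : σ i <;> simp [exchange, samplePoints, h]

-- Exchanges permute the same points, so a hypothesis may be replaced by its trace on them,
-- independently of `σ`; a union bound over traces follows.
open scoped Classical in
theorem card_exchange_mem_badPairs {X : Type*} (H : Set (X → Bool)) (t : X → Bool) {m : ℕ} (k : ℕ)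
    (z : (Fin m → X) × (Fin m → X)) :
    (Finset.univ.filter fun σ : Fin m → Bool => exchange σ z ∈ badPairs H t m k).card * 2 ^ k ≤
      (traces H (samplePoints z)).card * 2 ^ m := by
  let B : Finset X → Finset (Fin m → Bool) := fun A =>
    Finset.univ.filter fun σ : Fin m → Bool =>
      (∀ i, decide ((exchange σ z).1 i ∈ A) = t ((exchange σ z).1 i)) ∧
        k ≤ (disagreements (fun x => decide (x ∈ A)) t (exchange σ z).2).card
  have hsub : (Finset.univ.filter fun σ : Fin m → Bool => exchange σ z ∈ badPairs H t m k) ⊆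
      (traces H (samplePoints z)).biUnion B := by
    intro σ hσ
    obtain ⟨h, hH, h1, h2⟩ := (Finset.mem_filter.1 hσ).2
    refine Finset.mem_biUnion.2 ⟨_, mem_traces.2 ⟨h, hH, rfl⟩, ?_⟩
    have hdec : ∀ x ∈ samplePoints z,
        decide (x ∈ (samplePoints z).filter fun x => h x = true) = h x := by
      intro x hx
      simp [hx]
    refine Finset.mem_filter.2 ⟨Finset.mem_univ _, fun i => ?_, ?_⟩
    · rw [hdec _ (exchange_mem_samplePoints σ z i).1, h1 i]
    · refine h2.trans (Finset.card_le_card fun i hi => ?_)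
      refine Finset.mem_filter.2 ⟨Finset.mem_univ _, ?_⟩
      exact (hdec _ (exchange_mem_samplePoints σ z i).2).trans_ne (Finset.mem_filter.1 hi).2
  calc _ ≤ (∑ A ∈ traces H (samplePoints z), (B A).card) * 2 ^ k :=
        Nat.mul_le_mul_right _ ((Finset.card_le_card hsub).trans Finset.card_biUnion_le)
    _ = ∑ A ∈ traces H (samplePoints z), (B A).card * 2 ^ k := Finset.sum_mul _ _ _
    _ ≤ ∑ A ∈ traces H (samplePoints z), 2 ^ m :=
        Finset.sum_le_sum fun A _ => by
          convert card_exchange_single (fun x => decide (x ∈ A)) t k z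
    _ = _ := by rw [Finset.sum_const, smul_eq_mul]

/-! ### Uniform convergence over a countable discrete space -/

section Probability

-- Every set of samples is measurable here, so neither the union over `H` nor an arbitrary learning
-- rule raises a measurability question.
variable {X : Type*} [Countable X] [MeasurableSpace X] [MeasurableSingletonClass X]
  (D : Measure X) [IsProbabilityMeasure D]

theorem measurePreserving_exchange {m : ℕ} (σ : Fin m → Bool) :
    MeasurePreserving (exchange (X := X) σ)
      ((Measure.pi fun _ : Fin m => D).prod (Measure.pi fun _ : Fin m => D))
      ((Measure.pi fun _ : Fin m => D).prod (Measure.pi fun _ : Fin m => D)) := by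
  refine ⟨.of_discrete, Measure.ext_of_singleton fun z => ?_⟩
  rw [Measure.map_apply .of_discrete .of_discrete]
  have hpre : exchange σ ⁻¹' {z} = {exchange σ z} := by
    ext y
    simp only [Set.mem_preimage, Set.mem_singleton_iff]
    exact (exchange_involutive σ).eq_iff
  have hs : ∀ y : (Fin m → X) × (Fin m → X),
      ((Measure.pi fun _ : Fin m => D).prod (Measure.pi fun _ : Fin m => D)) {y} =
        ∏ i, (D {y.1 i} * D {y.2 i}) := by
    intro y
    rw [← Set.singleton_prod_singleton (a := y.1) (b := y.2), Measure.prod_prod,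
      Measure.pi_singleton, Measure.pi_singleton, Finset.prod_mul_distrib]
  rw [hpre, hs, hs]
  refine Finset.prod_congr rfl fun i _ => ?_
  cases h : σ i <;> simp [exchange, h, mul_comm]

/-- All exchanges give the bad event the same probability, so it equals the mean over pairs of the
fraction of exchanges that are bad. -/
theorem measureReal_badPairs_le (H : Set (X → Bool)) (t : X → Bool) (m k : ℕ) {G : ℝ}
    (hG : ∀ z : (Fin m → X) × (Fin m → X), ((traces H (samplePoints z)).card : ℝ) ≤ G) :
    ((Measure.pi fun _ : Fin m => D).prod (Measure.pi fun _ : Fin m => D)).real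
      (badPairs H t m k) * 2 ^ k ≤ G := by
  classical
  set ν := (Measure.pi fun _ : Fin m => D).prod (Measure.pi fun _ : Fin m => D) with hν
  let f : (Fin m → Bool) → ((Fin m → X) × (Fin m → X)) → ℝ := fun σ =>
    (exchange σ ⁻¹' badPairs H t m k).indicator 1
  have hint : ∀ σ, Integrable (f σ) ν := fun σ => (integrable_const (1 : ℝ)).indicator .of_discrete
  have hf : ∀ σ, ∫ z, f σ z ∂ν = ν.real (badPairs H t m k) := by
    intro σ
    rw [integral_indicator_one .of_discrete]
    exact (measurePreserving_exchange D σ).measureReal_preimage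
      (MeasurableSet.of_discrete.nullMeasurableSet)
  have hsum : 2 ^ m * ν.real (badPairs H t m k) = ∫ z, ∑ σ, f σ z ∂ν := by
    rw [integral_finsetSum _ fun σ _ => hint σ, Finset.sum_congr rfl fun σ _ => hf σ]
    simp
  have hpt : ∀ z, ∑ σ, f σ z ≤ G * 2 ^ m / 2 ^ k := by
    intro z
    have hc : ∑ σ, f σ z =
        ((Finset.univ.filter fun σ : Fin m → Bool => exchange σ z ∈ badPairs H t m k).card : ℝ) := by
      simp [f, Set.indicator_apply]
    rw [hc, le_div_iff₀ (by positivity)]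
    calc _ ≤ ((traces H (samplePoints z)).card : ℝ) * 2 ^ m := by
          exact_mod_cast card_exchange_mem_badPairs H t k z
      _ ≤ G * 2 ^ m := by gcongr; exact hG z
  have hle : ∫ z, ∑ σ, f σ z ∂ν ≤ G * 2 ^ m / 2 ^ k := by
    refine (integral_mono (integrable_finsetSum _ fun σ _ => hint σ)
      (integrable_const (G * 2 ^ m / 2 ^ k)) hpt).trans ?_
    simp
  rw [← hsum, le_div_iff₀ (by positivity)] at hle
  have h2m : (0 : ℝ) < 2 ^ m := by positivity
  nlinarith

/-- A Chernoff bound: Markov's inequality for `2 ^ (-N)`, with `N` the number of disagreements,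
whose mean is `(1 - p/2)^m ≤ exp (-ε m / 2)`. -/
theorem half_le_measureReal_disagreements {h t : X → Bool} {ε : ℝ} {m : ℕ}
    (hε : ε < D.real {x | h x ≠ t x}) (hm : 4 ≤ ε * m) :
    1 / 2 ≤ (Measure.pi fun _ : Fin m => D).real
      {x | ⌈ε * m / 4⌉₊ ≤ (disagreements h t x).card} := by
  set μ := Measure.pi fun _ : Fin m => D
  set p := D.real {x | h x ≠ t x} with hp
  have hp1 : p ≤ 1 := measureReal_le_one
  let g : X → ℝ := fun x => if h x ≠ t x then 1 / 2 else 1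
  have hgint : ∫ x, g x ∂D = 1 - p / 2 := by
    have hg : g = fun x => 1 - {x | h x ≠ t x}.indicator (fun _ => (1 / 2 : ℝ)) x := by
      funext x
      by_cases hx : h x = t x <;> (simp [g, hx]; try norm_num)
    rw [hg, integral_sub (integrable_const _) ((integrable_const _).indicator .of_discrete),
      integral_indicator_const _ .of_discrete]
    simp [← hp]
    ring
  have hprod : ∀ x : Fin m → X, ∏ i, g (x i) = (1 / 2 : ℝ) ^ (disagreements h t x).card := by
    intro x
    simp only [g]
    rw [← Finset.prod_filter, Finset.prod_const]
    rfl
  have hint : ∫ x, ∏ i, g (x i) ∂μ = (1 - p / 2) ^ m := by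
    rw [integral_fintype_prod_eq_pow, hgint, Fintype.card_fin]
  have hlt : {x : Fin m → X | ⌈ε * m / 4⌉₊ ≤ (disagreements h t x).card}ᶜ ⊆
      {x | Real.exp (-(Real.log 2 * (ε * m / 4))) ≤ ∏ i, g (x i)} := by
    intro x hx
    have hx' : ((disagreements h t x).card : ℝ) < ε * m / 4 := Nat.lt_ceil.1 (not_le.1 hx)
    rw [Set.mem_ofPred_eq, hprod, one_div, inv_pow, ← Real.exp_log (two_pos (α := ℝ)),
      ← Real.exp_nat_mul, ← Real.exp_neg, Real.exp_le_exp, Real.log_exp]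
    have := Real.log_pos one_lt_two
    nlinarith
  have hbound : Integrable (fun x : Fin m → X => ∏ i, g (x i)) μ := by
    refine Integrable.of_bound (Measurable.of_discrete.aestronglyMeasurable) 1 ?_
    refine Filter.Eventually.of_forall fun x => ?_
    rw [hprod, Real.norm_of_nonneg (by positivity)]
    exact pow_le_one₀ (by norm_num) (by norm_num)
  have hmarkov := mul_meas_ge_le_integral_of_nonneg
    (Filter.Eventually.of_forall fun x => by
      show (0 : ℝ) ≤ ∏ i, g (x i)
      rw [hprod]; positivity) hbound (Real.exp (-(Real.log 2 * (ε * m / 4))))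
  rw [hint] at hmarkov
  have hpow : (1 - p / 2) ^ m ≤ Real.exp (-(ε * m / 2)) := by
    calc (1 - p / 2) ^ m ≤ Real.exp (-(p / 2)) ^ m := by
          gcongr
          · linarith
          · exact Real.one_sub_le_exp_neg _
      _ = Real.exp (-(p * m / 2)) := by rw [← Real.exp_nat_mul]; congr 1; ring
      _ ≤ Real.exp (-(ε * m / 2)) := by
          gcongr
  have hcompl : μ.real {x : Fin m → X | ⌈ε * m / 4⌉₊ ≤ (disagreements h t x).card}ᶜ ≤ 1 / 2 := by
    refine (measureReal_mono hlt).trans ?_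
    have hle := hmarkov.trans hpow
    rw [← le_div_iff₀' (Real.exp_pos _), ← Real.exp_sub] at hle
    refine hle.trans ?_
    have hl := Real.log_two_lt_d9
    calc _ ≤ Real.exp (-Real.log 2) := by
          apply Real.exp_le_exp.2
          nlinarith
      _ = 1 / 2 := by rw [Real.exp_neg, Real.exp_log two_pos, one_div]
  rw [probReal_compl_eq_one_sub .of_discrete] at hcompl
  linarith

/-- The samples on which some `h ∈ H` of error more than `ε` agrees with `t`. -/
def misleadingSamples (H : Set (X → Bool)) (t : X → Bool) (ε : ℝ) (m : ℕ) : Set (Fin m → X) :=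
  {x | ∃ h ∈ H, (∀ i, h (x i) = t (x i)) ∧ ε < D.real {x | h x ≠ t x}}

theorem measureReal_misleadingSamples_le_badPairs (H : Set (X → Bool)) (t : X → Bool) {ε : ℝ}
    {m : ℕ} (hm : 4 ≤ ε * m) :
    (Measure.pi fun _ : Fin m => D).real (misleadingSamples D H t ε m) ≤
      2 * ((Measure.pi fun _ : Fin m => D).prod (Measure.pi fun _ : Fin m => D)).real
        (badPairs H t m ⌈ε * m / 4⌉₊) := by
  set μ := Measure.pi fun _ : Fin m => D
  have hslice : ∀ x ∈ misleadingSamples D H t ε m,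
      ENNReal.ofReal (1 / 2) ≤ μ (Prod.mk x ⁻¹' badPairs H t m ⌈ε * m / 4⌉₊) := by
    rintro x ⟨h, hH, hx, hε⟩
    calc _ ≤ μ {x' | ⌈ε * m / 4⌉₊ ≤ (disagreements h t x').card} := by
          rw [← ofReal_measureReal]
          exact ENNReal.ofReal_le_ofReal (half_le_measureReal_disagreements D hε hm)
      _ ≤ μ (Prod.mk x ⁻¹' badPairs H t m ⌈ε * m / 4⌉₊) :=
          measure_mono fun x' hx' => show (x, x') ∈ badPairs H t m _ from ⟨h, hH, hx, hx'⟩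
  have hle : ENNReal.ofReal (1 / 2) * μ (misleadingSamples D H t ε m) ≤
      (μ.prod μ) (badPairs H t m ⌈ε * m / 4⌉₊) := by
    rw [Measure.prod_apply .of_discrete, ← setLIntegral_const]
    exact (setLIntegral_mono' .of_discrete hslice).trans (setLIntegral_le_lintegral _ _)
  have := ENNReal.toReal_mono (measure_ne_top _ _) hle
  rw [ENNReal.toReal_mul, ENNReal.toReal_ofReal (by norm_num)] at this
  change 1 / 2 * μ.real _ ≤ (μ.prod μ).real _ at this
  linarith

/-- The realizable uniform convergence bound for a class of VC dimension at most `d`. -/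
theorem measureReal_misleadingSamples_le {H : Set (X → Bool)} {d m : ℕ} (hVC : VCdim H ≤ d)
    (hd : 1 ≤ d) (hdm : d ≤ 2 * m) (t : X → Bool) {ε : ℝ} (hm : 4 ≤ ε * m) :
    (Measure.pi fun _ : Fin m => D).real (misleadingSamples D H t ε m) ≤
      2 * (Real.exp d * (((2 * m : ℕ) : ℝ) / d) ^ d) / 2 ^ ⌈ε * m / 4⌉₊ := by
  have h1 := measureReal_misleadingSamples_le_badPairs D H t hm
  have h2 := measureReal_badPairs_le D H t m ⌈ε * m / 4⌉₊
    fun z => card_traces_le hVC hd hdm (card_samplePoints_le z)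
  rw [← le_div_iff₀ (by positivity)] at h2
  rw [mul_div_assoc]
  linarith

end Probability

/-! ### The sample size -/

theorem log_two_le_log_div {ε : ℝ} (hε : 0 < ε) (hε1 : ε < 1) :
    3 * Real.log 2 ≤ Real.log (32 / ε) := by
  rw [show 3 * Real.log 2 = Real.log (2 ^ 3) by rw [Real.log_pow]; norm_num]
  apply Real.log_le_log (by norm_num)
  rw [le_div_iff₀ hε]
  linarith

theorem growth_div_two_pow_le {d m : ℕ} {ε δ : ℝ} (hd : 1 ≤ d) (hε : 0 < ε) (hε1 : ε < 1)
    (hδ : 0 < δ) (hδ1 : δ < 1)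
    (hm : 16 * (2 * d * Real.log (32 / ε) + Real.log δ⁻¹) ≤ ε * m) :
    2 * (Real.exp d * (((2 * m : ℕ) : ℝ) / d) ^ d) / 2 ^ ⌈ε * m / 4⌉₊ ≤ δ := by
  have hd0 : (1 : ℝ) ≤ d := by exact_mod_cast hd
  have hl1 := Real.log_two_gt_d9
  have hL := log_two_le_log_div hε hε1
  have hδL : 0 < Real.log δ⁻¹ := Real.log_pos ((one_lt_inv₀ hδ).2 hδ1)
  have hdL : Real.log (32 / ε) ≤ d * Real.log (32 / ε) := by nlinarith
  have hm0 : (0 : ℝ) < m := by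
    by_contra hneg
    have : ε * m ≤ 0 := mul_nonpos_of_nonneg_of_nonpos hε.le (not_lt.1 hneg)
    nlinarith
  have hpow : Real.exp (Real.log 2 * (ε * m / 4)) ≤ 2 ^ ⌈ε * m / 4⌉₊ := by
    rw [← Real.rpow_natCast, Real.rpow_def_of_pos two_pos]
    gcongr
    exact Nat.le_ceil _
  rw [div_le_iff₀ (by positivity)]
  refine le_trans ?_ (mul_le_mul_of_nonneg_left hpow hδ.le)
  push_cast
  have hu : (0 : ℝ) < 2 * m / d := by positivity
  have hlog : Real.log (2 * m / d) ≤ ε * Real.log 2 / 16 * (2 * m / d) + Real.log (32 / ε) - 1 := by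
    -- This slope makes the linear term `ε m log 2 / 8`, half of the exponent available from `2 ^ ⌈ε
    -- * m / 4⌉₊`.
    have h1 := log_le_mul_add (a := ε * Real.log 2 / 16) (by positivity) hu
    have h2 : -Real.log (ε * Real.log 2 / 16) ≤ Real.log (32 / ε) := by
      rw [← Real.log_inv]
      apply Real.log_le_log (by positivity)
      rw [inv_div, div_le_div_iff₀ (by positivity) hε]
      nlinarith
    linarith
  have hdlog : d + d * Real.log (2 * m / d) ≤ ε * m * Real.log 2 / 8 + d * Real.log (32 / ε) := by
    calc d + d * Real.log (2 * m / d)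
        ≤ d + d * (ε * Real.log 2 / 16 * (2 * m / d) + Real.log (32 / ε) - 1) := by gcongr
      _ = _ := by field_simp; ring
  rw [← Real.log_le_log_iff (by positivity) (by positivity),
    Real.log_mul (by norm_num) (by positivity), Real.log_mul (by positivity) (by positivity),
    Real.log_mul (by positivity) (by positivity), Real.log_exp, Real.log_exp, Real.log_pow]
  rw [Real.log_inv] at hm hδL
  have hkey : 2 * d * Real.log (32 / ε) + -Real.log δ ≤ ε * m * Real.log 2 / 8 := by nlinarith
  linarith

/-- A sample size sufficient for consistent learning of a class of VC dimension at most `d`. -/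
noncomputable def consSampleSize (d : ℕ) (ε δ : ℝ) : ℕ :=
  -- For `d = 0` the ceiling would be at least `1`, whereas the required bound tends to `0` as `δ →
  -- 1`. No samples are needed: the class has at most one member.
  if d = 0 then 0 else ⌈16 / ε * (2 * d * Real.log (32 / ε) + Real.log δ⁻¹)⌉₊

theorem consSampleSize_le {d : ℕ} {ε₀ ε δ : ℝ} (hε : 0 < ε) (hε₀ : ε ≤ ε₀) (hε₀1 : ε₀ < 1)
    (hδ : 0 < δ) (hδ1 : δ < 1) :
    (consSampleSize d ε δ : ℝ) ≤
      34 * (1 + Real.log 32 / Real.log ε₀⁻¹) * (ε⁻¹ * (d * Real.log ε⁻¹ + Real.log δ⁻¹)) := by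
  have hε1 := hε₀.trans_lt hε₀1
  have hε₀0 := hε.trans_le hε₀
  have hδL : 0 < Real.log δ⁻¹ := Real.log_pos ((one_lt_inv₀ hδ).2 hδ1)
  have hεL : 0 < Real.log ε⁻¹ := Real.log_pos ((one_lt_inv₀ hε).2 hε1)
  have hL0 : 0 < Real.log ε₀⁻¹ := Real.log_pos ((one_lt_inv₀ hε₀0).2 hε₀1)
  have h32 : 0 < Real.log 32 := Real.log_pos (by norm_num)
  set C := 1 + Real.log 32 / Real.log ε₀⁻¹ with hC
  have hC1 : 1 ≤ C := by rw [hC, le_add_iff_nonneg_right]; positivity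
  unfold consSampleSize
  split_ifs with hd
  · rw [Nat.cast_zero]; positivity
  have hd0 : (1 : ℝ) ≤ d := by exact_mod_cast Nat.one_le_iff_ne_zero.2 hd
  -- Only here does `ε ≤ ε₀` matter quantitatively: `log 32` is absorbed because `log ε⁻¹ ≥ log ε₀⁻¹
  -- > 0`.
  have hlog : Real.log (32 / ε) ≤ C * Real.log ε⁻¹ := by
    rw [div_eq_mul_inv, Real.log_mul (by norm_num) (by positivity), hC, add_mul, one_mul, add_comm]
    gcongr
    rw [div_mul_eq_mul_div, le_div_iff₀ hL0]
    gcongr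
  have hL := log_two_le_log_div hε hε1
  have hl1 := Real.log_two_gt_d9
  set W := 2 * d * Real.log (32 / ε) + Real.log δ⁻¹ with hW
  have hW1 : 1 ≤ W := by nlinarith
  have hinv : 1 ≤ ε⁻¹ := (one_le_inv₀ hε).2 hε1.le
  have hWle : W ≤ 2 * C * (d * Real.log ε⁻¹ + Real.log δ⁻¹) := by
    have : (d : ℝ) * Real.log (32 / ε) ≤ d * (C * Real.log ε⁻¹) := by gcongr
    nlinarith
  calc (⌈16 / ε * W⌉₊ : ℝ) ≤ 16 / ε * W + 1 := (Nat.ceil_lt_add_one (by positivity)).le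
    _ ≤ 17 * ε⁻¹ * W := by
        rw [div_eq_mul_inv]
        nlinarith
    _ ≤ 17 * ε⁻¹ * (2 * C * (d * Real.log ε⁻¹ + Real.log δ⁻¹)) := by gcongr
    _ = _ := by ring

theorem measureReal_misleadingSamples_consSampleSize_le {X : Type*} [Countable X]
    [MeasurableSpace X] [MeasurableSingletonClass X] (D : Measure X) [IsProbabilityMeasure D]
    {H : Set (X → Bool)} {d : ℕ} (hVC : VCdim H ≤ d) (hd : 1 ≤ d) (t : X → Bool) {ε δ : ℝ}
    (hε : 0 < ε) (hε1 : ε < 1) (hδ : 0 < δ) (hδ1 : δ < 1) :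
    (Measure.pi fun _ : Fin (consSampleSize d ε δ) => D).real
      (misleadingSamples D H t ε (consSampleSize d ε δ)) ≤ δ := by
  have hm : 16 * (2 * d * Real.log (32 / ε) + Real.log δ⁻¹) ≤ ε * consSampleSize d ε δ := by
    rw [consSampleSize, if_neg (by omega), mul_comm ε, ← div_le_iff₀ hε]
    refine le_trans (le_of_eq (by ring)) (Nat.le_ceil _)
  have hd0 : (1 : ℝ) ≤ d := by exact_mod_cast hd
  have hL := log_two_le_log_div hε hε1
  have hl1 := Real.log_two_gt_d9
  have hδL : 0 < Real.log δ⁻¹ := Real.log_pos ((one_lt_inv₀ hδ).2 hδ1)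
  have hdL : (d : ℝ) ≤ d * Real.log (32 / ε) := by nlinarith
  have hmε : ε * consSampleSize d ε δ ≤ consSampleSize d ε δ :=
    mul_le_of_le_one_left (Nat.cast_nonneg _) hε1.le
  refine (measureReal_misleadingSamples_le D hVC hd ?_ t (by linarith)).trans
    (growth_div_two_pow_le hd hε hε1 hδ hδ1 hm)
  have : (d : ℝ) ≤ 2 * consSampleSize d ε δ := by linarith
  exact_mod_cast this

/-! ### Consistent rules learn -/

theorem exists_isConsRule (F : Set (List Bool → Bool)) (T : ℕ+) :
    ∃ A : LearningRule, IsConsRule F T A := by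
  classical
  refine ⟨fun S => if h : ∃ f ∈ F, ∀ p ∈ S, endToEnd f T p.1 = p.2 then endToEnd h.choose T
    else fun _ => false, fun S hS => ⟨hS.choose, hS.choose_spec.1, dif_pos hS, hS.choose_spec.2⟩⟩

theorem IsConsRule.apply_labelledSample {F : Set (List Bool → Bool)} {T : ℕ+} {A : LearningRule}
    (hA : IsConsRule F T A) {f : List Bool → Bool} (hf : f ∈ F) {m : ℕ} (x : Fin m → List Bool) :
    A (labelledSample f T x) ∈ endToEndClass F T ∧
      ∀ i, A (labelledSample f T x) (x i) = endToEnd f T (x i) := by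
  obtain ⟨g, hg, hAg, hcons⟩ := hA (labelledSample f T x) ⟨f, hf, by
    intro p hp
    obtain ⟨i, rfl⟩ := List.mem_ofFn.1 hp
    rfl⟩
  rw [hAg]
  exact ⟨⟨g, hg, rfl⟩, fun i => hcons (x i, endToEnd f T (x i)) (List.mem_ofFn.2 ⟨i, rfl⟩)⟩

theorem IsConsRule.learnsEndToEnd {F : Set (List Bool → Bool)} {T : ℕ+} {d : ℕ}
    (hVC : VCdim (endToEndClass F T) ≤ d) {A : LearningRule} (hA : IsConsRule F T A) :
    LearnsEndToEnd F T A (consSampleSize d) := by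
  intro D _ f hf ε δ hε hε1 hδ hδ1
  rcases Nat.eq_zero_or_pos d with rfl | hd
  · have huniv : {x : Fin (consSampleSize 0 ε δ) → List Bool |
        populationError D f T (A (labelledSample f T x)) ≤ ε} = Set.univ := by
      refine Set.eq_univ_of_forall fun x => ?_
      have hzero : VCdim (endToEndClass F T) = 0 := le_antisymm hVC zero_le
      have heq : A (labelledSample f T x) = endToEnd f T :=
        subsingleton_of_VCdim_eq_zero hzero (hA.apply_labelledSample hf x).1 ⟨f, hf, rfl⟩
      simp [populationError, heq, hε.le]
    rw [huniv, probReal_univ]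
    linarith
  · have hbad := measureReal_misleadingSamples_consSampleSize_le D hVC hd (endToEnd f T) hε hε1
      hδ hδ1
    rw [← sub_le_sub_iff_left 1, ← probReal_compl_eq_one_sub .of_discrete] at hbad
    refine hbad.trans (measureReal_mono fun x hx => ?_)
    obtain ⟨hmem, hagree⟩ := hA.apply_labelledSample hf x
    exact not_lt.1 fun hlt => hx ⟨_, hmem, hagree, hlt⟩

end AutoregressiveCoT


theorem mainTheorem3 :
    (∀ (F : Set (List Bool → Bool)) (T : ℕ+),
      AutoregressiveCoT.VCdim (AutoregressiveCoT.endToEndClass F T) ≤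
        6 * ((T : ℕ) : ℕ∞) * AutoregressiveCoT.VCdim F) ∧
    (∀ ε₀ : ℝ, 0 < ε₀ → ε₀ < 1 →
      ∃ c : ℝ, 0 < c ∧
        ∀ (F : Set (List Bool → Bool)) (T : ℕ+) (d : ℕ), AutoregressiveCoT.VCdim F = (d : ℕ∞) →
          ∃ m : ℝ → ℝ → ℕ,
            (∀ ε δ : ℝ, 0 < ε → ε ≤ ε₀ → 0 < δ → δ < 1 →
              (m ε δ : ℝ) ≤
                c * (ε⁻¹ * (((T : ℕ) : ℝ) * (d : ℝ) * Real.log ε⁻¹ + Real.log δ⁻¹))) ∧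
            (∃ A : AutoregressiveCoT.LearningRule, AutoregressiveCoT.IsConsRule F T A) ∧
            (∀ A : AutoregressiveCoT.LearningRule, AutoregressiveCoT.IsConsRule F T A →
              AutoregressiveCoT.LearnsEndToEnd F T A m)) := by

  refine ⟨AutoregressiveCoT.VCdim_endToEndClass_le, fun ε₀ hε₀ hε₀1 => ?_⟩
  have hL0 : 0 < Real.log ε₀⁻¹ := Real.log_pos ((one_lt_inv₀ hε₀).2 hε₀1)
  have h32 : 0 < Real.log 32 := Real.log_pos (by norm_num)
  -- The `6` is the constant of the dimension bound, taken out of the whole bracket since `log δ⁻¹ >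
  -- 0`.
  refine ⟨6 * (34 * (1 + Real.log 32 / Real.log ε₀⁻¹)), by positivity, fun F T d hd => ?_⟩
  have hVC : AutoregressiveCoT.VCdim (AutoregressiveCoT.endToEndClass F T) ≤
      ((6 * T * d : ℕ) : ℕ∞) := by
    have := AutoregressiveCoT.VCdim_endToEndClass_le F T
    rw [hd] at this
    exact_mod_cast this
  refine ⟨AutoregressiveCoT.consSampleSize (6 * T * d), fun ε δ hε hεε₀ hδ hδ1 => ?_,
    AutoregressiveCoT.exists_isConsRule F T, fun A hA => hA.learnsEndToEnd hVC⟩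
  have hδL : 0 < Real.log δ⁻¹ := Real.log_pos ((one_lt_inv₀ hδ).2 hδ1)
  calc _ ≤ 34 * (1 + Real.log 32 / Real.log ε₀⁻¹) *
        (ε⁻¹ * ((6 * T * d : ℕ) * Real.log ε⁻¹ + Real.log δ⁻¹)) :=
        AutoregressiveCoT.consSampleSize_le hε hεε₀ hε₀1 hδ hδ1
    _ ≤ 34 * (1 + Real.log 32 / Real.log ε₀⁻¹) *
        (ε⁻¹ * (6 * (((T : ℕ) : ℝ) * (d : ℝ) * Real.log ε⁻¹ + Real.log δ⁻¹))) := by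
        gcongr
        push_cast
        linarith
    _ = _ := by ring
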